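/- All graphs are finite, simple, undirected and nonempty. A graph $G$ is burned in rounds. Before the first round no vertex is on fire. In each round, first the fire spreads from every burning vertex to all of its neighbors, and then a new vertex that is not yet on fire (if there is one) is chosen and lit. The burning number $b(G)$ is the minimum number of rounds after which all vertices of $G$ can be on fire. A connected graph $G$ on $n$ vertices is called well-burnable if $b(G)\le\lceil\sqrt{n}\,\rceil$. A leaf is a vertex of degree $1$. For a positive integer $d$, let $\mathcal{T}_d$ be the class of trees in which every non-leaf vertex has degree at least $d$. Theorem. For every $d\ge 4$, every tree in $\mathcal{T}_d$ is well-burnable. Moreover, every tree in $\mathcal{T}_3$ on at least $81$ vertices is well-burnable. -/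

import Mathlib

namespace GraphBurning

/-- The vertices on fire after the fire has spread once from the set `B` of burning vertices:
the vertices of `B` and all their neighbours. -/
def spread {V : Type*} (G : SimpleGraph V) (B : Set V) : Set V :=
  B ∪ {v | ∃ u ∈ B, G.Adj u v}

/-- `Burns G t B`: some burning process on `G` has `B` as its set of vertices on fire after
`t` rounds. Before the first round nothing is on fire. In each round the fire first spreads to all
neighbours of burning vertices; then a new vertex, one that is not yet on fire, is lit, unless
no such vertex is left. -/
inductive Burns {V : Type*} (G : SimpleGraph V) : ℕ → Set V → Prop
  | start : Burns G 0 ∅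
  | light {t : ℕ} {B : Set V} (x : V) (h : Burns G t B) (hx : x ∉ spread G B) :
      Burns G (t + 1) (insert x (spread G B))
  | full {t : ℕ} {B : Set V} (h : Burns G t B) (hB : spread G B = Set.univ) :
      Burns G (t + 1) Set.univ

/-- The burning number `b(G)`: the minimum number of rounds in which all vertices of `G` can be
set on fire. For finite `G` the set of which the infimum is taken is nonempty, see
`exists_burns_univ`. -/
noncomputable def burningNumber {V : Type*} (G : SimpleGraph V) : ℕ :=
  sInf {t : ℕ | Burns G t Set.univ}

/-- A finite graph on `n` vertices is well-burnable if `b(G) ≤ ⌈√n⌉`. -/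
def IsWellBurnable {V : Type*} [Fintype V] (G : SimpleGraph V) : Prop :=
  burningNumber G ≤ ⌈Real.sqrt (Fintype.card V : ℝ)⌉₊

/-- The class of trees whose non-leaf vertices have degree at least `d`; a leaf is a vertex of
degree `1`. -/
def IsTreeWithNonLeafDegreeGE {V : Type*} [Fintype V] (G : SimpleGraph V) [DecidableRel G.Adj]
    (d : ℕ) : Prop :=
  G.IsTree ∧ ∀ v : V, G.degree v ≠ 1 → d ≤ G.degree v

/-- A finite graph can be burned completely, so that its burning number is attained. -/
theorem exists_burns_univ {V : Type*} [Fintype V] (G : SimpleGraph V) :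
    ∃ t : ℕ, Burns G t Set.univ := by
  classical
  have key : ∀ t : ℕ, ∃ B : Set V, Burns G t B ∧ (t ≤ B.ncard ∨ B = Set.univ) := by
    intro t
    induction t with
    | zero => exact ⟨∅, Burns.start, Or.inl (Nat.zero_le _)⟩
    | succ t ih =>
      obtain ⟨B, hB, hcard⟩ := ih
      have hsub : B ⊆ spread G B := Set.subset_union_left
      by_cases hfull : spread G B = Set.univ
      · exact ⟨Set.univ, Burns.full hB hfull, Or.inr rfl⟩
      · obtain ⟨x, hx⟩ := (Set.ne_univ_iff_exists_notMem _).1 hfull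
        refine ⟨_, Burns.light x hB hx, Or.inl ?_⟩
        rw [Set.ncard_insert_of_notMem hx (Set.toFinite _)]
        rcases hcard with h | h
        · have := Set.ncard_le_ncard hsub (Set.toFinite _)
          omega
        · exact absurd (Set.univ_subset_iff.1 (h ▸ hsub)) hfull
  obtain ⟨B, hB, h | h⟩ := key (Fintype.card V)
  · refine ⟨_, (?_ : B = Set.univ) ▸ hB⟩
    refine Set.eq_of_subset_of_ncard_le (Set.subset_univ _) ?_ (Set.toFinite _)
    rw [Set.ncard_univ, Nat.card_eq_fintype_card]
    exact h
  · exact ⟨_, h ▸ hB⟩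

end GraphBurning

/-! Burning in `k` rounds amounts to covering by balls of radii `0, …, k - 1`. The core,
`coverable_of_weight_le`, covers every rooted tree of weight at most `k ^ 2`, where a vertex with
exactly one child weighs 2 and any other weighs 1. The doubling makes a subtree of height `h` weigh
at least `2 * h + 1` (`height_le_weight`), while cutting off a subtree raises the weight of the rest
by at most 1 (`weight_sdiff_sub_add_le`). With `k = i + 1`, a tree of height at most `i` needs only
the ball of radius `i`. Otherwise take `p` of height `i + 1` and cut off a subtree near it: either
one of cost `(i + 1)^2 - i^2 = 2i + 1`, covered by the ball of radius `i`, or one of cost `(i + 1)^2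
- (i - 1)^2 = 4i`, covered by the balls of radii `i` and `i - 1`. A tree without vertices of degree
2, rooted at a non-leaf, has no vertex with a single child, so its weight is its order. This gives
the bound for every `d ≥ 3` and every order. -/

namespace GraphBurning

/-! ### Rooted trees, ancestors and coverings. -/

/-- A rooted tree structure on `V`, given by its parent map; the root is its own parent. -/
structure Rooting (V : Type*) where
  root : V
  parent : V → V
  depth : V → ℕ
  parent_root : parent root = root
  depth_root : depth root = 0
  depth_parent : ∀ v, v ≠ root → depth (parent v) + 1 = depth v

namespace Rooting

variable {V : Type*} (T : Rooting V)

/-- `u` is a descendant of `v`, possibly `v` itself. -/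
def Desc (u v : V) : Prop := ∃ a, T.parent^[a] u = v

/-- `u` and `v` are at distance at most `n`, as witnessed by a common ancestor. -/
def Near (n : ℕ) (u v : V) : Prop :=
  ∃ a b, a + b ≤ n ∧ T.parent^[a] u = T.parent^[b] v

/-- `S` contains the parent of each of its vertices. -/
def ParentClosed (S : Finset V) : Prop := ∀ v ∈ S, T.parent v ∈ S

/-- `S` is covered by balls of radii `0, …, k - 1`. -/
def Coverable (k : ℕ) (S : Finset V) : Prop :=
  ∃ f : ℕ → V, ∀ v ∈ S, ∃ i < k, T.Near i (f i) v

variable {T}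

theorem depth_parent_eq (v : V) : T.depth (T.parent v) = T.depth v - 1 := by
  by_cases h : v = T.root
  · subst h; simp [T.parent_root, T.depth_root]
  · have := T.depth_parent v h; omega

theorem depth_iterate (a : ℕ) (v : V) : T.depth (T.parent^[a] v) = T.depth v - a := by
  induction a with
  | zero => simp
  | succ a ih => rw [Function.iterate_succ_apply', depth_parent_eq, ih]; omega

theorem eq_root_of_depth {v : V} (h : T.depth v = 0) : v = T.root := by
  by_contra hv
  have := T.depth_parent v hv
  omega

theorem desc_refl (v : V) : T.Desc v v := ⟨0, rfl⟩

theorem Desc.trans {u v w : V} (h : T.Desc u v) (h' : T.Desc v w) : T.Desc u w := by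
  obtain ⟨a, rfl⟩ := h
  obtain ⟨b, rfl⟩ := h'
  exact ⟨b + a, Function.iterate_add_apply _ _ _ _⟩

theorem desc_parent (v : V) : T.Desc v (T.parent v) := ⟨1, rfl⟩

theorem Desc.depth_le {u v : V} (h : T.Desc u v) : T.depth v ≤ T.depth u := by
  obtain ⟨a, rfl⟩ := h
  rw [depth_iterate]; omega

/-- Iterating `parent` stalls at the root, so a witness of `Desc` may overshoot; the difference of
depths is always a valid witness. -/
theorem Desc.iterate_eq {u v : V} (h : T.Desc u v) :
    T.parent^[T.depth u - T.depth v] u = v := by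
  obtain ⟨a, ha⟩ := h
  induction a generalizing u with
  | zero => subst ha; simp
  | succ a ih =>
    by_cases hu : u = T.root
    · refine ih ?_
      rwa [Function.iterate_succ_apply, hu, T.parent_root, ← hu] at ha
    · have hd := T.depth_parent u hu
      have hv : T.depth v ≤ T.depth (T.parent u) := Desc.depth_le ⟨a, ha⟩
      have := ih ha
      rwa [← hd, Nat.sub_add_comm hv, Function.iterate_succ_apply]

theorem desc_root (v : V) : T.Desc v T.root :=
  ⟨T.depth v, eq_root_of_depth (by rw [depth_iterate]; omega)⟩

theorem Desc.near {u v : V} {n : ℕ} (h : T.Desc u v) (hn : T.depth u ≤ T.depth v + n) :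
    T.Near n v u :=
  ⟨0, T.depth u - T.depth v, by omega, h.iterate_eq.symm⟩

theorem Desc.near_of_parent_iterate {u v w : V} {a n : ℕ} (hv : T.parent^[a] v = w)
    (h : T.Desc u w) (hn : T.depth u + a ≤ T.depth w + n) (ha : a ≤ n) : T.Near n v u :=
  ⟨a, T.depth u - T.depth w, by omega, by rw [hv, h.iterate_eq]⟩

theorem Coverable.succ {k : ℕ} {S S' : Finset V} (h : T.Coverable k S') (c : V)
    (hS : ∀ v ∈ S, v ∈ S' ∨ T.Near k c v) : T.Coverable (k + 1) S := by
  obtain ⟨f, hf⟩ := h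
  refine ⟨Function.update f k c, fun v hv => ?_⟩
  rcases hS v hv with h | h
  · obtain ⟨i, hi, hn⟩ := hf v h
    exact ⟨i, by omega, by rwa [Function.update_of_ne (by omega)]⟩
  · exact ⟨k, by omega, by rwa [Function.update_self]⟩

theorem Coverable.add_two {k : ℕ} {S S' : Finset V} (h : T.Coverable k S') (c d : V)
    (hS : ∀ v ∈ S, v ∈ S' ∨ T.Near k c v ∨ T.Near (k + 1) d v) : T.Coverable (k + 2) S := by
  classical
  refine Coverable.succ (S' := S.filter fun v => ¬ T.Near (k + 1) d v) (h.succ c ?_) d ?_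
  · intro v hv
    rw [Finset.mem_filter] at hv
    rcases hS v hv.1 with h | h | h
    · exact Or.inl h
    · exact Or.inr h
    · exact absurd h hv.2
  · intro v hv
    by_cases h : T.Near (k + 1) d v
    · exact Or.inr h
    · exact Or.inl (Finset.mem_filter.2 ⟨hv, h⟩)

/-! ### Heights and weights of subtrees. -/

open Classical in
/-- The children of `v` that lie in `S`. -/
noncomputable def kids (T : Rooting V) (S : Finset V) (v : V) : Finset V :=
  S.filter fun u => u ≠ T.root ∧ T.parent u = v

open Classical in
/-- The descendants of `v` that lie in `S`. -/
noncomputable def sub (T : Rooting V) (S : Finset V) (v : V) : Finset V :=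
  S.filter fun u => T.Desc u v

/-- The height of the subtree of `S` rooted at `v`. -/
noncomputable def height (T : Rooting V) (S : Finset V) (v : V) : ℕ :=
  (T.sub S v).sup fun u => T.depth u - T.depth v

/-- The weight of a vertex: vertices with exactly one child in `S` count twice. -/
noncomputable def wt (T : Rooting V) (S : Finset V) (v : V) : ℕ :=
  1 + if (T.kids S v).card = 1 then 1 else 0

/-- The total weight of a set of vertices. -/
noncomputable def weight (T : Rooting V) (S X : Finset V) : ℕ := ∑ v ∈ X, T.wt S v

variable {S : Finset V} {u v w p : V}

theorem mem_kids : u ∈ T.kids S v ↔ u ∈ S ∧ u ≠ T.root ∧ T.parent u = v := by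
  simp [kids]

theorem mem_sub : u ∈ T.sub S v ↔ u ∈ S ∧ T.Desc u v := by
  simp [sub]

theorem depth_of_mem_kids (h : u ∈ T.kids S v) : T.depth u = T.depth v + 1 := by
  obtain ⟨-, hu, rfl⟩ := mem_kids.1 h
  exact (T.depth_parent u hu).symm

theorem desc_of_mem_kids (h : u ∈ T.kids S v) : T.Desc u v := by
  obtain ⟨-, -, rfl⟩ := mem_kids.1 h
  exact desc_parent u

theorem mem_of_mem_kids (h : u ∈ T.kids S v) : u ∈ S := (mem_kids.1 h).1

theorem self_mem_sub (h : v ∈ S) : v ∈ T.sub S v := mem_sub.2 ⟨h, desc_refl v⟩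

theorem sub_subset (h : u ∈ T.kids S v) : T.sub S u ⊆ T.sub S v := fun x hx => by
  rw [mem_sub] at hx ⊢
  exact ⟨hx.1, hx.2.trans (desc_of_mem_kids h)⟩

theorem notMem_sub_of_mem_kids (h : u ∈ T.kids S v) : v ∉ T.sub S u := fun hv => by
  have := (mem_sub.1 hv).2.depth_le
  have := depth_of_mem_kids h
  omega

theorem disjoint_sub (hu : u ∈ T.kids S v) (hw : w ∈ T.kids S v) (huw : u ≠ w) :
    Disjoint (T.sub S u) (T.sub S w) := by
  rw [Finset.disjoint_left]
  intro x hx hx'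
  apply huw
  rw [← (mem_sub.1 hx).2.iterate_eq, ← (mem_sub.1 hx').2.iterate_eq,
    depth_of_mem_kids hu, depth_of_mem_kids hw]

theorem ParentClosed.iterate (hS : T.ParentClosed S) (hv : v ∈ S) (a : ℕ) :
    T.parent^[a] v ∈ S := by
  induction a with
  | zero => exact hv
  | succ a ih => rw [Function.iterate_succ_apply']; exact hS _ ih

theorem eq_or_exists_kid (hS : T.ParentClosed S) (hu : u ∈ T.sub S v) :
    u = v ∨ ∃ w ∈ T.kids S v, u ∈ T.sub S w := by
  obtain ⟨huS, hd⟩ := mem_sub.1 hu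
  have hi := hd.iterate_eq
  rcases hk : T.depth u - T.depth v with _ | k
  · rw [hk] at hi; exact Or.inl hi
  · rw [hk, Function.iterate_succ_apply'] at hi
    refine Or.inr ⟨T.parent^[k] u, mem_kids.2 ⟨hS.iterate huS k, fun h => ?_, hi⟩,
      mem_sub.2 ⟨huS, k, rfl⟩⟩
    have := depth_iterate (T := T) k u
    rw [h, T.depth_root] at this
    omega

theorem depth_le_height (hu : u ∈ T.sub S v) : T.depth u ≤ T.depth v + T.height S v := by
  have := Finset.le_sup (f := fun u => T.depth u - T.depth v) hu
  change _ ≤ T.height S v at this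
  omega

theorem height_kid_lt (hu : u ∈ T.kids S v) : T.height S u < T.height S v := by
  obtain ⟨x, hx, hh⟩ := Finset.exists_mem_eq_sup (T.sub S u) ⟨u, self_mem_sub (mem_of_mem_kids hu)⟩
    (fun x => T.depth x - T.depth u)
  have h1 := depth_le_height (sub_subset hu hx)
  have h2 := depth_of_mem_kids hu
  have h3 := depth_le_height (sub_subset hu (self_mem_sub (mem_of_mem_kids hu)))
  unfold height at *
  omega

theorem exists_kid_height (hS : T.ParentClosed S) {h : ℕ} (hh : T.height S v = h + 1) :
    ∃ u ∈ T.kids S v, T.height S u = h := by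
  have hne : (T.sub S v).Nonempty := by
    rw [Finset.nonempty_iff_ne_empty]
    intro h0
    simp [height, h0] at hh
  obtain ⟨x, hx, hx'⟩ := Finset.exists_mem_eq_sup (T.sub S v) hne
    (fun x => T.depth x - T.depth v)
  have hx' : T.height S v = T.depth x - T.depth v := hx'
  rcases eq_or_exists_kid hS hx with rfl | ⟨u, hu, hxu⟩
  · omega
  · refine ⟨u, hu, ?_⟩
    have h1 := depth_le_height hxu
    have h2 := depth_of_mem_kids hu
    have h3 := height_kid_lt hu
    omega

theorem exists_mem_height (hS : T.ParentClosed S) {h : ℕ} (hv : v ∈ S)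
    (hh : h ≤ T.height S v) : ∃ p ∈ S, T.height S p = h := by
  induction hn : T.height S v - h generalizing v with
  | zero => exact ⟨v, hv, by omega⟩
  | succ n ih =>
    obtain ⟨u, hu, huh⟩ := exists_kid_height hS (h := T.height S v - 1) (v := v) (by omega)
    exact ih (mem_of_mem_kids hu) (by omega) (by omega)

theorem one_le_wt (v : V) : 1 ≤ T.wt S v := by unfold wt; omega

theorem wt_le_two (v : V) : T.wt S v ≤ 2 := by unfold wt; split <;> omega

theorem weight_mono {X Y : Finset V} (h : X ⊆ Y) : T.weight S X ≤ T.weight S Y :=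
  Finset.sum_le_sum_of_subset h

theorem card_le_weight (X : Finset V) : X.card ≤ T.weight S X := by
  rw [Finset.card_eq_sum_ones]
  exact Finset.sum_le_sum fun v _ => one_le_wt v

theorem weight_two_kids (hv : v ∈ S) (hu : u ∈ T.kids S v) (hw : w ∈ T.kids S v) (huw : u ≠ w) :
    1 + T.weight S (T.sub S u) + T.weight S (T.sub S w) ≤ T.weight S (T.sub S v) := by
  classical
  have hd := disjoint_sub hu hw huw
  have hn : v ∉ T.sub S u ∪ T.sub S w := by
    simp [notMem_sub_of_mem_kids hu, notMem_sub_of_mem_kids hw]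
  have hsub : insert v (T.sub S u ∪ T.sub S w) ⊆ T.sub S v :=
    Finset.insert_subset (self_mem_sub hv) (Finset.union_subset (sub_subset hu) (sub_subset hw))
  have h := weight_mono (T := T) (S := S) hsub
  have h1 := one_le_wt (T := T) (S := S) v
  unfold weight at *
  rw [Finset.sum_insert hn, Finset.sum_union hd] at h
  omega

/-- Either `u` is the only child and `v` weighs 2, or a second child contributes the missing unit.
-/
theorem weight_kid (hv : v ∈ S) (hu : u ∈ T.kids S v) :
    2 + T.weight S (T.sub S u) ≤ T.weight S (T.sub S v) := by
  classical
  by_cases hc : (T.kids S v).card = 1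
  · have h := weight_mono (T := T) (S := S)
      (Finset.insert_subset (self_mem_sub hv) (sub_subset hu))
    have h1 : T.wt S v = 2 := by simp [wt, hc]
    unfold weight at *
    rw [Finset.sum_insert (notMem_sub_of_mem_kids hu)] at h
    omega
  · have hpos := Finset.card_pos.2 ⟨u, hu⟩
    obtain ⟨w, hw, hwu⟩ := Finset.exists_mem_ne (by omega : 1 < (T.kids S v).card) u
    have h := weight_two_kids hv hu hw hwu.symm
    have h1 := card_le_weight (T := T) (S := S) (T.sub S w)
    have h2 := Finset.card_pos.2 ⟨w, self_mem_sub (T := T) (mem_of_mem_kids hw)⟩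
    omega

/-- Each step up a longest downward path adds at least 2, by `weight_kid`. -/
theorem height_le_weight (hS : T.ParentClosed S) (hv : v ∈ S) :
    2 * T.height S v + 1 ≤ T.weight S (T.sub S v) := by
  induction hh : T.height S v generalizing v with
  | zero =>
    have h1 := card_le_weight (T := T) (S := S) (T.sub S v)
    have h2 := Finset.card_pos.2 ⟨v, self_mem_sub (T := T) hv⟩
    omega
  | succ n ih =>
    obtain ⟨u, hu, huh⟩ := exists_kid_height hS hh
    have h1 := ih (mem_of_mem_kids hu) huh
    have h2 := weight_kid hv hu
    omega

/-! ### Cutting off a subtree. -/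

variable [DecidableEq V]

theorem ParentClosed.sdiff_sub (hS : T.ParentClosed S) (p : V) :
    T.ParentClosed (S \ T.sub S p) := by
  intro v hv
  rw [Finset.mem_sdiff, mem_sub] at hv ⊢
  exact ⟨hS v hv.1, fun h => hv.2 ⟨hv.1, (desc_parent v).trans h.2⟩⟩

theorem kids_sdiff_sub (hvp : v ≠ T.parent p) (hv : v ∉ T.sub S p) (hvS : v ∈ S) :
    T.kids (S \ T.sub S p) v = T.kids S v := by
  ext x
  simp only [mem_kids, Finset.mem_sdiff]
  refine ⟨fun h => ⟨h.1.1, h.2⟩, fun h => ⟨⟨h.1, fun hx => ?_⟩, h.2⟩⟩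
  obtain ⟨a, ha⟩ := (mem_sub.1 hx).2
  rcases a with _ | a
  · exact hvp (by rw [← ha]; exact h.2.2.symm)
  · rw [Function.iterate_succ_apply, h.2.2] at ha
    exact hv (mem_sub.2 ⟨hvS, a, ha⟩)

theorem card_kids_le_sdiff_sub (hp : p ≠ T.root) :
    (T.kids S (T.parent p)).card ≤ (T.kids (S \ T.sub S p) (T.parent p)).card + 1 := by
  refine (Finset.card_le_card (t := insert p (T.kids (S \ T.sub S p) (T.parent p))) ?_).trans
    (Finset.card_insert_le _ _)
  intro x hx
  rw [Finset.mem_insert]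
  by_cases hxp : x = p
  · exact Or.inl hxp
  · refine Or.inr (mem_kids.2 ⟨Finset.mem_sdiff.2 ⟨mem_of_mem_kids hx, fun h => hxp ?_⟩,
      (mem_kids.1 hx).2⟩)
    have h1 := depth_of_mem_kids hx
    have h2 := T.depth_parent p hp
    have h3 := (mem_sub.1 h).2.iterate_eq
    rwa [h1, h2, Nat.sub_self] at h3

/-- Removing a subtree turns at most one vertex into a vertex with exactly one child. -/
theorem weight_sdiff_sub_add_le (p : V) :
    T.weight (S \ T.sub S p) (S \ T.sub S p) + T.weight S (T.sub S p) ≤ T.weight S S + 1 := by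
  have hsub : T.sub S p ⊆ S := fun x hx => (mem_sub.1 hx).1
  have h : T.weight (S \ T.sub S p) (S \ T.sub S p) ≤ T.weight S (S \ T.sub S p) + 1 := by
    unfold weight
    by_cases hm : T.parent p ∈ S \ T.sub S p
    · rw [← Finset.add_sum_erase _ _ hm, ← Finset.add_sum_erase _ (fun v => T.wt S v) hm,
        Finset.sum_congr rfl (g := fun v => T.wt S v)]
      · have h1 := wt_le_two (T := T) (S := S \ T.sub S p) (T.parent p)
        have h2 := one_le_wt (T := T) (S := S) (T.parent p)
        omega
      · intro v hv
        rw [Finset.mem_erase, Finset.mem_sdiff] at hv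
        unfold wt
        rw [kids_sdiff_sub hv.1 hv.2.2 hv.2.1]
    · rw [Finset.sum_congr rfl (g := fun v => T.wt S v)]
      · omega
      · intro v hv
        have hv' := Finset.mem_sdiff.1 hv
        unfold wt
        rw [kids_sdiff_sub (fun h => hm (h ▸ hv)) hv'.2 hv'.1]
  have h2 := Finset.sum_sdiff (f := fun v => T.wt S v) hsub
  unfold weight at *
  omega

/-- Removing the subtree of one of at least three children makes no vertex have exactly one
child. -/
theorem weight_sdiff_sub_add_le_of_three (hp : p ≠ T.root)
    (h3 : 3 ≤ (T.kids S (T.parent p)).card) :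
    T.weight (S \ T.sub S p) (S \ T.sub S p) + T.weight S (T.sub S p) ≤ T.weight S S := by
  have hsub : T.sub S p ⊆ S := fun x hx => (mem_sub.1 hx).1
  have h : T.weight (S \ T.sub S p) (S \ T.sub S p) ≤ T.weight S (S \ T.sub S p) := by
    refine Finset.sum_le_sum fun v hv => ?_
    have hv' := Finset.mem_sdiff.1 hv
    by_cases hvp : v = T.parent p
    · have := card_kids_le_sdiff_sub (S := S) hp
      have h1 : T.wt (S \ T.sub S p) v = 1 := by
        rw [wt, if_neg (by rw [hvp]; omega)]
      rw [h1]
      exact one_le_wt v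
    · unfold wt
      rw [kids_sdiff_sub hvp hv'.2 hv'.1]
  have h2 := Finset.sum_sdiff (f := fun v => T.wt S v) hsub
  unfold weight at *
  omega

end Rooting

end GraphBurning

/-! ### Covering a rooted tree by balls of distinct radii. -/

namespace GraphBurning

namespace Rooting

variable {V : Type*} {T : Rooting V} {S : Finset V} {u v w p : V}

theorem near_of_mem_sub {n : ℕ} (h : u ∈ T.sub S v) (hn : T.height S v ≤ n) : T.Near n v u :=
  (mem_sub.1 h).2.near ((depth_le_height h).trans (by omega))

/-- A ball around a child `v` of `p` reaches the shallow branches below `p`. -/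
theorem near_of_mem_sub_sibling {n : ℕ} (hv : v ∈ T.kids S p) (hw : w ∈ T.kids S p)
    (hu : u ∈ T.sub S w) (hn : T.height S w + 2 ≤ n) : T.Near n v u := by
  have h1 := depth_le_height hu
  have h2 := depth_of_mem_kids hw
  exact ((mem_sub.1 hu).2.trans (desc_of_mem_kids hw)).near_of_parent_iterate (a := 1)
    (mem_kids.1 hv).2.2 (by omega) (by omega)

theorem near_parent {n : ℕ} (hv : v ∈ T.kids S p) (hn : 1 ≤ n) : T.Near n v p :=
  (desc_refl p).near_of_parent_iterate (a := 1) (mem_kids.1 hv).2.2 (by omega) (by omega)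

/-- If the other branches below `p` are shallow, a ball around the child `v` covers the whole
subtree of `p`. -/
theorem near_of_shallow_siblings {n : ℕ} (hS : T.ParentClosed S) (hv : v ∈ T.kids S p)
    (hn : T.height S v ≤ n) (hn1 : 1 ≤ n)
    (hsh : ∀ w ∈ T.kids S p, w ≠ v → T.height S w + 2 ≤ n) (hu : u ∈ T.sub S p) :
    T.Near n v u := by
  rcases eq_or_exists_kid hS hu with rfl | ⟨w, hw, huw⟩
  · exact near_parent hv hn1
  · by_cases hwv : w = v
    · subst hwv
      exact near_of_mem_sub huw hn
    · exact near_of_mem_sub_sibling hv hw huw (hsh w hw hwv)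

theorem eq_or_eq_of_card_kids_lt_three {x : V} (h : (T.kids S p).card < 3)
    (hv : v ∈ T.kids S p) (hw : w ∈ T.kids S p) (hvw : v ≠ w) (hx : x ∈ T.kids S p) :
    x = v ∨ x = w := by
  classical
  by_contra! hne
  have := Finset.card_le_card (s := {x, v, w}) (t := T.kids S p)
    (by simp [Finset.insert_subset_iff, hv, hw, hx])
  rw [Finset.card_eq_three.2 ⟨x, v, w, hne.1, hne.2, hvw, rfl⟩] at this
  omega

/-- A rooted tree of weight at most `k ^ 2` is covered by balls of radii `0, …, k - 1`. -/
theorem coverable_of_weight_le (k : ℕ) (hS : T.ParentClosed S) (hk : T.weight S S ≤ k ^ 2) :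
    T.Coverable k S := by
  classical
  induction k using Nat.strong_induction_on generalizing S with
  | _ k ih =>
  rcases k with _ | i
  · have h0 : S = ∅ := by
      have := card_le_weight (T := T) (S := S) S
      exact Finset.card_eq_zero.1 (by omega)
    exact ⟨fun _ => T.root, by simp [h0]⟩
  -- Spend the ball of radius `i` on the subtree at `x`; the rest must have lost `(i + 1)^2 - i^2 =
  -- 2i + 1`.
  have ih1 : ∀ x : V, ∀ c : V, 2 * i + 1 + T.weight (S \ T.sub S x) (S \ T.sub S x) ≤
      T.weight S S → (∀ u ∈ T.sub S x, T.Near i c u) → T.Coverable (i + 1) S := by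
    intro x c hw hc
    refine (ih i (by omega) (hS.sdiff_sub x) (by nlinarith)).succ c fun u hu => ?_
    by_cases hux : u ∈ T.sub S x
    · exact Or.inr (hc u hux)
    · exact Or.inl (Finset.mem_sdiff.2 ⟨hu, hux⟩)
  by_cases hdeep : ∃ r ∈ S, i + 1 ≤ T.height S r
  swap
  · refine ⟨fun _ => T.root, fun v hv => ⟨i, by omega, ?_⟩⟩
    have hr : T.root ∈ S := by
      obtain ⟨a, ha⟩ := desc_root (T := T) v
      exact ha ▸ hS.iterate hv a
    exact near_of_mem_sub (S := S) (mem_sub.2 ⟨hv, desc_root v⟩)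
      (by by_contra! h; exact hdeep ⟨_, hr, h⟩)
  obtain ⟨r, hr, hri⟩ := hdeep
  obtain ⟨p, hp, hpi⟩ := exists_mem_height hS hr hri
  obtain ⟨v, hv, hvi⟩ := exists_kid_height hS hpi
  have hpw := height_le_weight hS hp
  have hvw := height_le_weight hS (mem_of_mem_kids hv)
  have hpS : T.weight S (T.sub S p) ≤ T.weight S S :=
    weight_mono fun x hx => (mem_sub.1 hx).1
  have hpd := weight_sdiff_sub_add_le (T := T) (S := S) p
  -- The subtree at `p` weighs at least `2i + 3`, which exceeds `(i + 1)^2` for `i ≤ 1`.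
  have hi2 : 2 ≤ i := by
    by_contra! h
    interval_cases i <;> omega
  -- Spend the two largest balls on the subtree at `p`; the rest must have lost `(i + 1)^2 - (i -
  -- 1)^2 = 4i`.
  have ih2 : ∀ c d : V, 4 * i + T.weight (S \ T.sub S p) (S \ T.sub S p) ≤
      T.weight S S → (∀ u ∈ T.sub S p, T.Near (i - 1) c u ∨ T.Near i d u) →
      T.Coverable (i + 1) S := by
    intro c d hw hc
    obtain ⟨j, rfl⟩ : ∃ j, i = j + 1 := ⟨i - 1, by omega⟩
    refine (ih j (by omega) (hS.sdiff_sub p) (by nlinarith)).add_two c d fun u hu => ?_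
    by_cases hup : u ∈ T.sub S p
    · exact Or.inr (hc u hup)
    · exact Or.inl (Finset.mem_sdiff.2 ⟨hu, hup⟩)
  by_cases hsh : ∀ w ∈ T.kids S p, w ≠ v → T.height S w + 2 ≤ i
  · exact ih1 p v (by omega) fun u hu =>
      near_of_shallow_siblings hS hv hvi.le (by omega) hsh hu
  push Not at hsh
  obtain ⟨w, hw, hwv, hwi⟩ := hsh
  -- With a third child, cutting at `v` incurs no penalty, so the weight `2i + 1` of that branch
  -- suffices.
  by_cases hc : 3 ≤ (T.kids S p).card
  · have hvp := (mem_kids.1 hv).2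
    have h := weight_sdiff_sub_add_le_of_three hvp.1 (hvp.2.symm ▸ hc)
    exact ih1 v v (by omega) fun u hu => near_of_mem_sub hu hvi.le
  have htwo := fun x hx => eq_or_eq_of_card_kids_lt_three (x := x) (by omega) hv hw hwv.symm hx
  have hvww := weight_two_kids hp hv hw hwv.symm
  have hww := height_le_weight hS (mem_of_mem_kids hw)
  have hwlt := height_kid_lt hw
  have hcov : ∀ d, (∀ u ∈ T.sub S w, T.Near (i - 1) d u) →
      ∀ u ∈ T.sub S p, T.Near (i - 1) d u ∨ T.Near i v u := by
    intro d hd u hu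
    rcases eq_or_exists_kid hS hu with rfl | ⟨x, hx, hux⟩
    · exact Or.inr (near_parent hv (by omega))
    · rcases htwo x hx with rfl | rfl
      · exact Or.inr (near_of_mem_sub hux hvi.le)
      · exact Or.inl (hd u hux)
  -- The height of `w` is `i - 1` or `i`, so the subtree at `p` weighs at least `1 + (2i + 1) + (2i
  -- - 1) = 4i + 1`, which pays for both balls and the penalty.
  by_cases hwi' : T.height S w = i - 1
  · exact ih2 w v (by omega) (hcov w fun u hu => near_of_mem_sub hu hwi'.le)
  obtain ⟨w', hw', hwi''⟩ := exists_kid_height hS (v := w) (h := i - 1) (by omega)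
  by_cases hsh' : ∀ x ∈ T.kids S w, x ≠ w' → T.height S x + 2 ≤ i - 1
  · exact ih2 w' v (by omega) (hcov w' fun u hu =>
      near_of_shallow_siblings hS hw' hwi''.le (by omega) hsh' hu)
  push Not at hsh'
  obtain ⟨x, hx, hxw, hxi⟩ := hsh'
  -- For `i = 2` both `v` and `w` have height 2, so the subtree at `p` weighs at least 11, more than
  -- `3 ^ 2`.
  have h3 : 3 ≤ i := by
    by_contra! h
    obtain rfl : i = 2 := by omega
    omega
  -- The subtree at `w` weighs at least `1 + (2i - 1) + (2i - 3) = 4i - 3`; less the penalty, this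
  -- is at least `2i + 1` because `i ≥ 3`.
  have h4 := weight_two_kids (mem_of_mem_kids hw) hx hw' hxw
  have h5 := height_le_weight hS (mem_of_mem_kids hx)
  have h6 := height_le_weight hS (mem_of_mem_kids hw')
  have h7 := weight_sdiff_sub_add_le (T := T) (S := S) w
  exact ih1 w w (by omega) fun u hu => near_of_mem_sub hu (by omega)

end Rooting

end GraphBurning

/-! ### From coverings by balls to burning processes. -/

namespace GraphBurning

section Fire

variable {V : Type*} {G : SimpleGraph V}

theorem spread_mono {A B : Set V} (h : A ⊆ B) : spread G A ⊆ spread G B :=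
  Set.union_subset_union h fun _ ⟨u, hu, huv⟩ => ⟨u, h hu, huv⟩

theorem subset_spread (B : Set V) : B ⊆ spread G B := Set.subset_union_left

/-- Balls around prescribed centres can be set on fire one after the other. -/
theorem exists_burns_spread_iterate (f : ℕ → V) (t : ℕ) :
    ∃ B : Set V, Burns G t B ∧ ∀ j < t, (spread G)^[t - 1 - j] {f j} ⊆ B := by
  induction t with
  | zero => exact ⟨∅, .start, by simp⟩
  | succ t ih =>
    obtain ⟨B, hB, hf⟩ := ih
    have hspread : ∀ j < t, (spread G)^[t + 1 - 1 - j] {f j} ⊆ spread G B := by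
      intro j hj
      rw [show t + 1 - 1 - j = t - 1 - j + 1 by omega, Function.iterate_succ_apply']
      exact spread_mono (hf j hj)
    by_cases hfull : spread G B = Set.univ
    · exact ⟨Set.univ, .full hB hfull, fun _ _ => Set.subset_univ _⟩
    -- If the prescribed centre already burns, any vertex not yet on fire is lit in its place.
    obtain ⟨x, hx, hxf⟩ : ∃ x ∉ spread G B, f t ∈ insert x (spread G B) := by
      by_cases hft : f t ∈ spread G B
      · obtain ⟨x, hx⟩ := (Set.ne_univ_iff_exists_notMem _).1 hfull
        exact ⟨x, hx, Or.inr hft⟩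
      · exact ⟨f t, hft, Or.inl rfl⟩
    refine ⟨_, .light x hB hx, fun j hj => ?_⟩
    rcases Nat.lt_succ_iff_lt_or_eq.1 hj with hj | rfl
    · exact (hspread j hj).trans (Set.subset_insert _ _)
    · simpa using hxf

theorem burningNumber_le_of_cover {k : ℕ} (f : ℕ → V)
    (hf : ∀ v, ∃ i < k, v ∈ (spread G)^[i] {f i}) : burningNumber G ≤ k := by
  -- Centres are lit in order of decreasing radius, as the earliest fire spreads furthest.
  obtain ⟨B, hB, h⟩ := exists_burns_spread_iterate (G := G) (fun j => f (k - 1 - j)) k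
  have : B = Set.univ := by
    refine Set.eq_univ_of_forall fun v => ?_
    obtain ⟨i, hi, hv⟩ := hf v
    refine h (k - 1 - i) (by omega) ?_
    rwa [show k - 1 - (k - 1 - i) = i by omega]
  exact Nat.sInf_le (this ▸ hB)

theorem mem_spread_iterate_of_le {c v : V} {m n : ℕ} (hmn : m ≤ n)
    (h : v ∈ (spread G)^[m] {c}) : v ∈ (spread G)^[n] {c} := by
  induction hmn with
  | refl => exact h
  | step _ ih => rw [Function.iterate_succ_apply']; exact subset_spread _ ih

end Fire

/-! ### Rooting a graph-theoretic tree. -/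

namespace Rooting

variable {V : Type*} {G : SimpleGraph V} {T : Rooting V}

theorem parent_iterate_mem_spread (hT : ∀ v, v ≠ T.root → G.Adj v (T.parent v)) (c : V) (a : ℕ) :
    T.parent^[a] c ∈ (spread G)^[a] {c} := by
  induction a with
  | zero => rfl
  | succ a ih =>
    rw [Function.iterate_succ_apply', Function.iterate_succ_apply']
    by_cases h : T.parent^[a] c = T.root
    · rw [h, T.parent_root, ← h]; exact subset_spread _ ih
    · exact Or.inr ⟨_, ih, hT _ h⟩

theorem mem_spread_of_parent_iterate (hT : ∀ v, v ≠ T.root → G.Adj v (T.parent v)) {c v : V}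
    {a b : ℕ} (h : T.parent^[b] v ∈ (spread G)^[a] {c}) : v ∈ (spread G)^[a + b] {c} := by
  induction b generalizing v with
  | zero => exact h
  | succ b ih =>
    have h' := ih (v := T.parent v) h
    rw [← Nat.add_assoc, Function.iterate_succ_apply']
    by_cases hv : v = T.root
    · rw [hv, T.parent_root, ← hv] at h'; exact subset_spread _ h'
    · exact Or.inr ⟨_, h', (hT v hv).symm⟩

theorem Near.mem_spread (hT : ∀ v, v ≠ T.root → G.Adj v (T.parent v)) {n : ℕ} {c v : V}
    (h : T.Near n c v) : v ∈ (spread G)^[n] {c} := by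
  obtain ⟨a, b, hab, heq⟩ := h
  exact mem_spread_iterate_of_le hab
    (mem_spread_of_parent_iterate hT (heq ▸ parent_iterate_mem_spread hT c a))

theorem burningNumber_le [Fintype V] (hT : ∀ v, v ≠ T.root → G.Adj v (T.parent v)) {k : ℕ}
    (hk : T.weight Finset.univ Finset.univ ≤ k ^ 2) : burningNumber G ≤ k := by
  obtain ⟨f, hf⟩ := coverable_of_weight_le (T := T) k (fun _ _ => Finset.mem_univ _) hk
  refine burningNumber_le_of_cover f fun v => ?_
  obtain ⟨i, hi, h⟩ := hf v (Finset.mem_univ _)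
  exact ⟨i, hi, h.mem_spread hT⟩

/-- A tree can be rooted at any vertex. -/
theorem exists_of_isTree (hG : G.IsTree) (r : V) :
    ∃ T : Rooting V, T.root = r ∧ (∀ v, v ≠ T.root → G.Adj v (T.parent v)) ∧
      ∀ u v, G.Adj u v → T.parent u = v ∨ (v ≠ T.root ∧ T.parent v = u) := by
  classical
  choose P hP _ using fun v => hG.existsUnique_path v r
  have hnil : ∀ v, v ≠ r → ¬ (P v).Nil := fun v hv => SimpleGraph.Walk.not_nil_of_ne hv
  refine ⟨⟨r, fun v => if v = r then r else (P v).snd, fun v => (P v).length, by simp, ?_, ?_⟩,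
    rfl, ?_, ?_⟩
  · simpa using hP r
  · intro v hv
    change v ≠ r at hv
    have hs : (if v = r then r else (P v).snd) = (P v).snd := if_neg hv
    change (P (if v = r then r else (P v).snd)).length + 1 = (P v).length
    rw [hs]
    have h := (hG.existsUnique_path (P v).snd r).unique (hP _) (hP v).tail
    rw [h, SimpleGraph.Walk.length_tail_add_one (hnil v hv)]
  · intro v hv
    change v ≠ r at hv
    simp only [hv, if_false]
    exact SimpleGraph.Walk.adj_snd (hnil v hv)
  · intro u v huv
    simp only
    -- If `v` lies on the path from `u` to `r`, acyclicity makes it the second vertex; otherwise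
    -- prepending `v` gives the path from `v`.
    by_cases hs : v ∈ (P u).support
    · have hv := hG.isAcyclic.eq_snd_of_adj_start (hP u) huv hs
      have hu : u ≠ r := by
        rintro rfl
        rw [SimpleGraph.Walk.nil_iff_support_eq.1 (SimpleGraph.Walk.isPath_iff_nil.1 (hP u)),
          List.mem_singleton] at hs
        exact huv.ne hs.symm
      exact Or.inl (by rw [if_neg hu, hv])
    · have hvr : v ≠ r := by
        rintro rfl
        exact hs (SimpleGraph.Walk.end_mem_support _)
      have hc : (SimpleGraph.Walk.cons huv.symm (P u)).IsPath := (hP u).cons hs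
      have h := (hG.existsUnique_path v r).unique (hP v) hc
      exact Or.inr ⟨hvr, by rw [if_neg hvr, h]; simp⟩

/-- In a tree without vertices of degree two, rooted at a vertex of degree other than one, no
vertex has exactly one child. -/
theorem card_kids_ne_one [Fintype V] [DecidableRel G.Adj]
    (hT : ∀ v, v ≠ T.root → G.Adj v (T.parent v))
    (hT' : ∀ u v, G.Adj u v → T.parent u = v ∨ (v ≠ T.root ∧ T.parent v = u))
    (hdeg : ∀ v, G.degree v ≠ 1 → 3 ≤ G.degree v) (hr : G.degree T.root ≠ 1) (v : V) :
    (T.kids Finset.univ v).card ≠ 1 := by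
  classical
  intro hc
  by_cases hv : G.degree v = 1
  · obtain ⟨u, hu⟩ := Finset.card_eq_one.1 hc
    have hu' : u ∈ T.kids Finset.univ v := by simp [hu]
    have hvr : v ≠ T.root := fun h => hr (h ▸ hv)
    have hd := depth_of_mem_kids hu'
    have hd' := T.depth_parent v hvr
    obtain ⟨-, hur, huv⟩ := mem_kids.1 hu'
    have := (G.degree_eq_one_iff_existsUnique_adj.1 hv).unique (huv ▸ (hT u hur).symm) (hT v hvr)
    rw [← this] at hd'
    omega
  · have h3 := hdeg v hv
    have hsub : G.neighborFinset v ⊆ insert (T.parent v) (T.kids Finset.univ v) := by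
      intro u hu
      rw [SimpleGraph.mem_neighborFinset] at hu
      rcases hT' v u hu with h | h
      · simp [h]
      · exact Finset.mem_insert_of_mem (mem_kids.2 ⟨Finset.mem_univ _, h⟩)
    have h1 := (Finset.card_le_card hsub).trans (Finset.card_insert_le _ _)
    rw [SimpleGraph.card_neighborFinset_eq_degree] at h1
    omega

end Rooting

/-! ### Conclusion for trees without vertices of degree 2. -/

/-- A tree without vertices of degree two burns in `k` rounds if it has at most `k ^ 2`
vertices. -/
theorem burningNumber_le_of_isTree {V : Type*} [Fintype V] {G : SimpleGraph V} [DecidableRel G.Adj]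
    (hG : G.IsTree) (hdeg : ∀ v, G.degree v ≠ 1 → 3 ≤ G.degree v) {k : ℕ}
    (hk : Fintype.card V ≤ k ^ 2) : burningNumber G ≤ k := by
  by_cases hr : ∃ r, G.degree r ≠ 1
  · obtain ⟨r, hr⟩ := hr
    obtain ⟨T, rfl, hT, hT'⟩ := Rooting.exists_of_isTree hG r
    refine Rooting.burningNumber_le hT (le_trans (le_of_eq ?_) hk)
    have : ∀ v, T.wt Finset.univ v = 1 := fun v => by
      rw [Rooting.wt, if_neg (Rooting.card_kids_ne_one hT hT' hdeg hr v)]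
    simp [Rooting.weight, this]
  -- If all vertices are leaves, the tree is a single edge: its weight is at most 4, and `2 ≤ k ^ 2`
  -- forces `k ≥ 2`.
  · push Not at hr
    obtain ⟨r⟩ := hG.connected.nonempty
    obtain ⟨T, rfl, hT, -⟩ := Rooting.exists_of_isTree hG r
    have h2 : Fintype.card V = 2 := by
      have h1 := hG.card_edgeFinset
      have h2 := G.sum_degrees_eq_twice_card_edges
      simp [hr] at h2
      omega
    refine Rooting.burningNumber_le hT ?_
    have hw : T.weight Finset.univ Finset.univ ≤ 2 * Fintype.card V := by
      refine (Finset.sum_le_card_nsmul _ _ 2 fun v _ => Rooting.wt_le_two v).trans ?_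
      simp [mul_comm]
    have hk2 : 2 ≤ k := by
      by_contra! h
      interval_cases k <;> omega
    nlinarith

theorem isWellBurnable_of_three_le {V : Type*} [Fintype V] {G : SimpleGraph V} [DecidableRel G.Adj]
    {d : ℕ} (hd : 3 ≤ d) (hG : IsTreeWithNonLeafDegreeGE G d) : IsWellBurnable G := by
  refine burningNumber_le_of_isTree hG.1 (fun v hv => hd.trans (hG.2 v hv)) ?_
  have h := Nat.le_ceil (Real.sqrt (Fintype.card V : ℝ))
  have h' := (Real.sqrt_le_left (Nat.cast_nonneg _)).1 h
  exact_mod_cast h'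

end GraphBurning

theorem theorem4p2 {V : Type*} [Fintype V] (G : SimpleGraph V) [DecidableRel G.Adj] :
    (∀ d : ℕ, 4 ≤ d → GraphBurning.IsTreeWithNonLeafDegreeGE G d →
      GraphBurning.IsWellBurnable G) ∧
    (GraphBurning.IsTreeWithNonLeafDegreeGE G 3 → 81 ≤ Fintype.card V →
      GraphBurning.IsWellBurnable G) :=
  ⟨fun _ hd hG => GraphBurning.isWellBurnable_of_three_le (by omega) hG,
    fun hG _ => GraphBurning.isWellBurnable_of_three_le le_rfl hG⟩
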